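/- **Theorem 1.1 (The Main Theorem).** Let $\lambda$ be $\aleph_0$ or a strong limit cardinal of cofinality $\aleph_0$. (1) Let $\langle G_m,\pi_{m,n} : m\le n<\omega\rangle$ be an inverse system of (not necessarily abelian) groups with $|G_n|<\lambda$ for every $n$; that is, $\pi_{m,n}:G_n\to G_m$ is a homomorphism for $m\le n$, $\pi_{m,m}=\mathrm{id}$, and $\pi_{k,m}\circ\pi_{m,n}=\pi_{k,n}$ for $k\le m\le n$. Let $G_\omega$ be its inverse limit. (2) Let $I$ be a finite index set and for every $t\in I$ let $\langle H^t_m,\pi^t_{m,n} : m\le n<\omega\rangle$ be an inverse system of groups with $|H^t_n|<\lambda$ for every $n$, and let $H^t_\omega$ be its inverse limit. (3) For every $t\in I$ and $n<\omega$ let $\sigma^t_n:H^t_n\to G_n$ be a homomorphism such that $\pi_{m,n}\circ\sigma^t_n=\sigma^t_m\circ\pi^t_{m,n}$ for all $m\le n<\omega$, and let $\sigma^t_\omega:H^t_\omega\to G_\omega$ be the induced homomorphism. Assume that for every cardinal $\mu<\lambda$ there is a sequence $\langle f_i\in G_\omega : i<\mu\rangle$ such that $f_if_j^{-1}\notin\operatorname{Rang}(\sigma^t_\omega)$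 for all $i\ne j$ and all $t\in I$. Then there is a sequence $\langle f_i\in G_\omega : i<2^\lambda\rangle$ such that $f_if_j^{-1}\notin\operatorname{Rang}(\sigma^t_\omega)$ for all $i\neq j$ and all $t\in I$. -/

import Mathlib

universe u v

/-- The inverse limit of a sequence of groups `G n` with bonding maps `π h : G n →* G m` for
`h : m ≤ n`: the group of coherent sequences, with coordinatewise multiplication. The projection
to `G n` is evaluation at `n`. -/
def inverseLimit {G : ℕ → Type u} [∀ n, Group (G n)]
    (π : ∀ ⦃m n : ℕ⦄, m ≤ n → G n →* G m) : Subgroup (∀ n, G n) where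
  carrier := {x | ∀ ⦃m n : ℕ⦄ (h : m ≤ n), π h (x n) = x m}
  one_mem' := by
    intro m n h
    simp
  mul_mem' := by
    intro x y hx hy m n h
    simp [hx h, hy h]
  inv_mem' := by
    intro x hx m n h
    simp [hx h]

/-- The homomorphism of inverse limits induced by a family of homomorphisms `σ n : H n →* G n`
that commutes with the bonding maps. -/
def inverseLimitMap {H G : ℕ → Type u} [∀ n, Group (H n)] [∀ n, Group (G n)]
    {ρ : ∀ ⦃m n : ℕ⦄, m ≤ n → H n →* H m} {π : ∀ ⦃m n : ℕ⦄, m ≤ n → G n →* G m}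
    (σ : ∀ n, H n →* G n)
    (hσ : ∀ ⦃m n : ℕ⦄ (h : m ≤ n), (π h).comp (σ n) = (σ m).comp (ρ h)) :
    inverseLimit ρ →* inverseLimit π where
  toFun x := ⟨fun n => σ n (x.1 n), by
    intro m n h
    have h1 := DFunLike.congr_fun (hσ h) (x.1 n)
    simp only [MonoidHom.comp_apply] at h1
    rw [h1, x.2 h]⟩
  map_one' := by
    ext n
    simp
  map_mul' x y := by
    ext n
    simp

/-! An element lies in the range of the limit of `σ t` iff its tree of partial preimages has an
infinite branch, so ordinal ranks on that tree measure failure. They give two decreasing chains of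
subgroups: `oneRankSubgroup`, closed under infinite products of deeper and deeper factors, and the
larger `someRankSubgroup`, which always contains the range. At each level their intersections below
a given rank differ by few cosets.

Take a maximal tuple `γ` such that the joint subgroups of ranks below `γ` have many cosets modulo
every range. Maximality gives them, near `γ`, many cosets modulo each subgroup of rank `γ t` as well
(`exists_threshold_of_maximal`). The lemma on chains and Neumann's lemma then yield any number below
`lam` of elements separated for all `t` at once, at ranks still below `γ`.

Iterating builds a tree of height ω whose branches are infinite products. At the first split of two
branches, the later factors have too high a rank to undo the separation. Countable cofinality makes
the number of branches `2 ^ lam`. -/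

/-! ### Strong limit cardinals -/

theorem Cardinal.IsStrongLimit.power_lt {lam a b : Cardinal.{u}} (h : lam.IsStrongLimit)
    (ha : a < lam) (hb : b < lam) : a ^ b < lam := by
  calc a ^ b ≤ (2 ^ a) ^ b := Cardinal.power_le_power_right (Cardinal.cantor a).le
    _ = 2 ^ (a * b) := Cardinal.power_mul.symm
    _ < lam := h.isStrongPrelimit (Cardinal.mul_lt_of_lt h.aleph0_le ha hb)

theorem Cardinal.IsStrongLimit.mk_fun_lt {lam : Cardinal.{u}} (h : lam.IsStrongLimit)
    {α β : Type u} (ha : Cardinal.mk α < lam) (hb : Cardinal.mk β < lam) :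
    Cardinal.mk (α → β) < lam := by
  rw [← Cardinal.power_def]
  exact h.power_lt hb ha

theorem Cardinal.IsStrongLimit.mk_set_lt {lam : Cardinal.{u}} (h : lam.IsStrongLimit)
    {α : Type u} (ha : Cardinal.mk α < lam) : Cardinal.mk (Set α) < lam := by
  rw [Cardinal.mk_set]
  exact h.isStrongPrelimit ha

theorem Cardinal.IsStrongLimit.mk_prod_lt {lam : Cardinal.{u}} (h : lam.IsStrongLimit)
    {α β : Type u} (ha : Cardinal.mk α < lam) (hb : Cardinal.mk β < lam) :
    Cardinal.mk (α × β) < lam := by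
  rw [← Cardinal.mul_def]
  exact Cardinal.mul_lt_of_lt h.aleph0_le ha hb

theorem Cardinal.IsStrongLimit.mk_sum_lt {lam : Cardinal.{u}} (h : lam.IsStrongLimit)
    {α β : Type u} (ha : Cardinal.mk α < lam) (hb : Cardinal.mk β < lam) :
    Cardinal.mk (α ⊕ β) < lam := by
  rw [← Cardinal.add_def]
  exact Cardinal.add_lt_of_lt h.aleph0_le ha hb

/-- A strong limit cardinal of countable cofinality has a power set no larger than a countable
product of power sets of smaller sets. -/
theorem Cardinal.IsStrongLimit.exists_two_power_le_mk_pi {lam : Cardinal.{u}}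
    (h : lam.IsStrongLimit) (hcof : lam.ord.cof = Cardinal.aleph0) :
    ∃ κ : ℕ → Type u, (∀ n, Cardinal.mk (κ n) < lam) ∧
      (2 : Cardinal.{u}) ^ lam ≤ Cardinal.mk (∀ n, Set (κ n)) := by
  rw [← Ordinal.cof_toType] at hcof
  obtain ⟨s, hs, hsc⟩ := Order.exists_cof_eq lam.ord.ToType
  rw [hcof] at hsc
  have e : Nonempty (ℕ ≃ s) := by
    rw [← Cardinal.lift_mk_eq'.{0, u}, hsc]; simp
  obtain ⟨e⟩ := e
  -- Initial segments ending at a countable cofinal set: each is small, and a subset of `lam` is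
  -- determined by its traces on them.
  refine ⟨fun n => Set.Iic (e n).1, fun n => ?_, ?_⟩
  · beta_reduce
    rw [← Set.Iio_insert]
    refine (Cardinal.mk_insert_le).trans_lt ?_
    exact Cardinal.add_lt_of_lt h.aleph0_le ((Cardinal.mk_Iio_lt _ (by simp)).trans_eq
      (by simp))
      (Cardinal.one_lt_aleph0.trans_le h.aleph0_le)
  · have h1 : lam ≤ Cardinal.mk (Σ n, Set.Iic (e n).1) := by
      have hl : Cardinal.mk lam.ord.ToType = lam := by simp
      conv_lhs => rw [← hl]
      refine Cardinal.mk_le_of_surjective (f := fun x => x.2.1) fun x => ?_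
      obtain ⟨y, hy, hxy⟩ := hs x
      exact ⟨⟨e.symm ⟨y, hy⟩, ⟨x, by simpa using hxy⟩⟩, rfl⟩
    calc (2 : Cardinal.{u}) ^ lam ≤ 2 ^ Cardinal.mk (Σ n, Set.Iic (e n).1) :=
          Cardinal.power_le_power_left two_ne_zero h1
      _ = Cardinal.mk (Set (Σ n, Set.Iic (e n).1)) := Cardinal.mk_set.symm
      _ ≤ _ := by
        refine Cardinal.mk_le_of_injective
          (f := fun (S : Set (Σ n, Set.Iic (e n).1)) n => {x | (⟨n, x⟩ : Σ n, Set.Iic (e n).1) ∈ S})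
          fun S T hST => ?_
        ext ⟨n, x⟩
        exact Set.ext_iff.1 (congrFun hST n) x

/-- A family indexed by `ι` of pairwise `P`-related elements of `A` exists as soon as every
family has an element of `A` related to all its members. -/
theorem exists_pairwise_of_forall_exists {Γ : Type*} {ι : Type*} [Nonempty Γ] (A : Set Γ)
    (P : Γ → Γ → Prop) (hP : ∀ a b, P a b → P b a)
    (h : ∀ g : ι → Γ, ∃ a ∈ A, ∀ i, P a (g i)) :
    ∃ f : ι → Γ, (∀ i, f i ∈ A) ∧ ∀ i j, i ≠ j → P (f i) (f j) := by
  classical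
  obtain ⟨r, wo⟩ : ∃ r : ι → ι → Prop, IsWellOrder ι r := ⟨WellOrderingRel, inferInstance⟩
  choose c hcA hc using h
  -- The arbitrary value only fills indices not before `i`; nothing is claimed about those.
  let f : ι → Γ := wo.wf.fix fun i rec =>
    c fun j => if hj : r j i then rec j hj else Classical.arbitrary Γ
  have hf : ∀ i, f i = c fun j => if r j i then f j else Classical.arbitrary Γ := by
    intro i
    have := wo.wf.fix_eq (C := fun _ => Γ) (fun i rec =>
      c fun j => if hj : r j i then rec j hj else Classical.arbitrary Γ) i
    simpa [f, dite_eq_ite] using this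
  have key : ∀ i j, r j i → P (f i) (f j) := by
    intro i j hji
    have := hc (fun j => if r j i then f j else Classical.arbitrary Γ) j
    rw [← hf, if_pos hji] at this
    exact this
  refine ⟨f, fun i => by rw [hf]; exact hcA _, fun i j hij => ?_⟩
  rcases trichotomous_of r i j with h1 | h1 | h1
  · exact hP _ _ (key _ _ h1)
  · exact (hij h1).elim
  · exact key _ _ h1

/-! ### Covering by few cosets -/

section Covers

variable {Γ : Type u} [Group Γ]

/-- The subgroup `A` is covered by `ι`-many right cosets of the subgroup `B`. -/
def CosetCover (ι : Type*) (B A : Subgroup Γ) : Prop :=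
  ∃ g : ι → Γ, ∀ a ∈ A, ∃ i, a * (g i)⁻¹ ∈ B

/-- The subgroup `A` is covered by fewer than `lam` right cosets of the subgroup `B`. -/
def SmallCosetCover (lam : Cardinal.{u}) (B A : Subgroup Γ) : Prop :=
  ∃ ι : Type u, Cardinal.mk ι < lam ∧ CosetCover ι B A

theorem CosetCover.mono {ι : Type*} {A A' B B' : Subgroup Γ} (h : CosetCover ι B A)
    (hA : A' ≤ A) (hB : B ≤ B') : CosetCover ι B' A' := by
  obtain ⟨g, hg⟩ := h
  refine ⟨g, fun a ha => ?_⟩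
  obtain ⟨i, hi⟩ := hg a (hA ha)
  exact ⟨i, hB hi⟩

theorem CosetCover.of_embedding {ι κ : Type*} {A B : Subgroup Γ} (h : CosetCover ι B A)
    (e : ι ↪ κ) : CosetCover κ B A := by
  obtain ⟨g, hg⟩ := h
  refine ⟨Function.extend e g 1, fun a ha => ?_⟩
  obtain ⟨i, hi⟩ := hg a ha
  exact ⟨e i, by rwa [e.injective.extend_apply]⟩

theorem SmallCosetCover.mono {lam : Cardinal.{u}} {A A' B B' : Subgroup Γ}
    (h : SmallCosetCover lam B A) (hA : A' ≤ A) (hB : B ≤ B') : SmallCosetCover lam B' A' := by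
  obtain ⟨ι, hι, h⟩ := h
  exact ⟨ι, hι, h.mono hA hB⟩

theorem SmallCosetCover.trans {lam : Cardinal.{u}} (hlam : lam.IsStrongLimit)
    {A B C : Subgroup Γ}
    (h : SmallCosetCover lam B A) (h' : SmallCosetCover lam C B) : SmallCosetCover lam C A := by
  obtain ⟨ι, hι, g, hg⟩ := h
  obtain ⟨κ, hκ, k, hk⟩ := h'
  refine ⟨ι × κ, hlam.mk_prod_lt hι hκ, fun p => k p.2 * g p.1, fun a ha => ?_⟩
  obtain ⟨i, hi⟩ := hg a ha
  obtain ⟨j, hj⟩ := hk _ hi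
  exact ⟨(i, j), by simpa [mul_assoc] using hj⟩

theorem SmallCosetCover.of_map {lam : Cardinal.{u}} {A B : Subgroup Γ} {X : Type u}
    (hX : Cardinal.mk X < lam) (φ : Γ → X)
    (h : ∀ a ∈ A, ∀ b ∈ A, φ a = φ b → a * b⁻¹ ∈ B) : SmallCosetCover lam B A := by
  classical
  refine ⟨X, hX, fun x => if hx : ∃ a ∈ A, φ a = x then hx.choose else 1, fun a ha => ?_⟩
  have hx : ∃ b ∈ A, φ b = φ a := ⟨a, ha, rfl⟩
  refine ⟨φ a, ?_⟩
  beta_reduce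
  rw [dif_pos hx]
  exact h _ ha _ hx.choose_spec.1 hx.choose_spec.2.symm

theorem CosetCover.exists_map {ι : Type*} {A B : Subgroup Γ} (h : CosetCover ι B A) :
    ∃ φ : Γ → ι, ∀ a ∈ A, ∀ b ∈ A, φ a = φ b → a * b⁻¹ ∈ B := by
  classical
  obtain ⟨g, hg⟩ := h
  have : Nonempty ι := ⟨(hg 1 A.one_mem).choose⟩
  refine ⟨fun a => if ha : a ∈ A then (hg a ha).choose else Classical.arbitrary ι,
    fun a ha b hb hab => ?_⟩
  simp only [dif_pos ha, dif_pos hb] at hab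
  have h1 := (hg a ha).choose_spec
  have h2 := (hg b hb).choose_spec
  rw [← hab] at h2
  simpa [mul_assoc] using B.mul_mem h1 (B.inv_mem h2)

theorem SmallCosetCover.inf_left {lam : Cardinal.{u}} {A B : Subgroup Γ}
    (h : SmallCosetCover lam B A) : SmallCosetCover lam (A ⊓ B) A := by
  obtain ⟨ι, hι, h⟩ := h
  obtain ⟨φ, hφ⟩ := h.exists_map
  exact SmallCosetCover.of_map hι φ fun a ha b hb hab =>
    ⟨A.mul_mem ha (A.inv_mem hb), hφ a ha b hb hab⟩

theorem CosetCover.injective_of_separated {ι κ : Type*} {A B : Subgroup Γ} (h : CosetCover ι B A)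
    {f : κ → Γ} (hf : ∀ i, f i ∈ A) (hsep : ∀ i j, i ≠ j → f i * (f j)⁻¹ ∉ B) :
    ∃ e : κ → ι, Function.Injective e := by
  obtain ⟨φ, hφ⟩ := h.exists_map
  refine ⟨φ ∘ f, fun i j hij => ?_⟩
  by_contra hne
  exact hsep i j hne (hφ _ (hf i) _ (hf j) hij)

theorem exists_separated_of_not_cosetCover {ι : Type*} {A B : Subgroup Γ}
    (h : ¬ CosetCover ι B A) :
    ∃ f : ι → Γ, (∀ i, f i ∈ A) ∧ ∀ i j, i ≠ j → f i * (f j)⁻¹ ∉ B := by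
  refine exists_pairwise_of_forall_exists (A : Set Γ) (fun a b => a * b⁻¹ ∉ B) ?_ ?_
  · intro a b hab hba
    exact hab (by simpa using B.inv_mem hba)
  · intro g
    simp only [CosetCover, not_exists, not_forall] at h
    obtain ⟨a, ha, h⟩ := h g
    exact ⟨a, ha, h⟩

/-- A cardinal version of B. H. Neumann's lemma: a group is not the union of few cosets of
finitely many subgroups of large index. -/
theorem exists_forall_mul_inv_notMem {lam : Cardinal.{u}} (hlam : lam.IsStrongLimit)
    {I : Type v} (s : Finset I) :
    ∀ ι : Type u, Cardinal.mk ι < lam → ∃ κ : Type u, Cardinal.mk κ < lam ∧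
      ∀ (A : Subgroup Γ) (B : I → Subgroup Γ), (∀ t ∈ s, ¬ CosetCover κ (B t) A) →
        ∀ g : ι → Γ, ∃ a ∈ A, ∀ t ∈ s, ∀ i, a * (g i)⁻¹ ∉ B t := by
  classical
  induction s using Finset.induction_on with
  | empty =>
    intro ι hι
    exact ⟨ι, hι, fun A B _ g => ⟨1, A.one_mem, by simp⟩⟩
  | insert t s ht ih =>
    intro ι hι
    obtain ⟨κ, hκ, H⟩ := ih (ι ⊕ ι × ι) (hlam.mk_sum_lt hι (hlam.mk_prod_lt hι hι))
    refine ⟨κ ⊕ ι, hlam.mk_sum_lt hκ hι, fun A B hB g => ?_⟩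
    have ht' : ¬ CosetCover ι (B t) A := fun h =>
      hB t (Finset.mem_insert_self _ _) (h.of_embedding Function.Embedding.inr)
    simp only [CosetCover, not_exists, not_forall] at ht'
    obtain ⟨a₀, ha₀, h₀⟩ := ht' g
    by_contra hcov
    push Not at hcov
    -- Representatives in `A` of the cosets of `B t`. If `a` falls into the coset of `c i`, then `a
    -- * (c i)⁻¹ * a₀` lies in `B t * a₀`, which misses every `B t * g j`; the family handed to `H`
    -- makes it avoid the other subgroups too.
    let c : ι → Γ := fun i => if h : ∃ a ∈ A, a * (g i)⁻¹ ∈ B t then h.choose else 1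
    obtain ⟨a, ha, hs⟩ := H A B
      (fun r hr h => hB r (Finset.mem_insert_of_mem hr) (h.of_embedding Function.Embedding.inl))
      (Sum.elim g fun p => g p.1 * a₀⁻¹ * c p.2)
    obtain ⟨r, hr, i, hi⟩ := hcov a ha
    rcases Finset.mem_insert.1 hr with rfl | hr
    · have hex : ∃ a ∈ A, a * (g i)⁻¹ ∈ B r := ⟨a, ha, hi⟩
      have hc : c i = hex.choose := dif_pos hex
      have hcA : c i ∈ A := hc ▸ hex.choose_spec.1
      have hcB : c i * (g i)⁻¹ ∈ B r := hc ▸ hex.choose_spec.2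
      have hb : a * (c i)⁻¹ ∈ B r := by
        simpa [mul_assoc] using (B r).mul_mem hi ((B r).inv_mem hcB)
      obtain ⟨q, hq, j, hj⟩ := hcov (a * (c i)⁻¹ * a₀)
        (A.mul_mem (A.mul_mem ha (A.inv_mem hcA)) ha₀)
      rcases Finset.mem_insert.1 hq with rfl | hq
      · refine h₀ j ?_
        have := (B q).mul_mem ((B q).inv_mem hb) hj
        simpa [mul_assoc] using this
      · refine hs q hq (Sum.inr (j, i)) ?_
        simpa [mul_assoc] using hj
    · exact hs r hr (Sum.inl i) hi

/-- If every member of a decreasing chain of subgroups has few cosets in `A`, so does the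
intersection of the chain. -/
theorem SmallCosetCover.iInf_of_antitone {lam : Cardinal.{u}} (hlam : lam.IsStrongLimit)
    {J : Type*} [LinearOrder J] [Nonempty J] {M : J → Subgroup Γ} (hM : Antitone M)
    {A : Subgroup Γ} {ι : Type u} (hι : Cardinal.mk ι < lam) (h : ∀ ε, CosetCover ι (M ε) A) :
    SmallCosetCover lam (⨅ ε, M ε) A := by
  by_cases hS : CosetCover (Set ι) (⨅ ε, M ε) A
  · exact ⟨Set ι, hlam.mk_set_lt hι, hS⟩
  obtain ⟨f, hfA, hf⟩ := exists_separated_of_not_cosetCover hS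
  have hex : ∀ p : {p : Set ι × Set ι // p.1 ≠ p.2}, ∃ ε, f p.1.1 * (f p.1.2)⁻¹ ∉ M ε := by
    intro p
    simpa [Subgroup.mem_iInf] using hf _ _ p.2
  choose d hd using hex
  -- If all separating indices lay below `ε`, then `M ε` would separate `2 ^ |ι|` elements while
  -- having at most `|ι|` cosets. So few indices are cofinal, and the cosets at those indices
  -- determine the coset of the intersection.
  have hcof : ∀ ε, ∃ p, ε ≤ d p := by
    by_contra! hb
    obtain ⟨ε, hε⟩ := hb
    obtain ⟨e, he⟩ := (h ε).injective_of_separated hfA fun i j hij hm =>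
      hd ⟨(i, j), hij⟩ (hM (hε _).le hm)
    exact Function.cantor_injective e he
  choose φ hφ using fun ε => (h ε).exists_map
  refine SmallCosetCover.of_map (X := {p : Set ι × Set ι // p.1 ≠ p.2} → ι)
    (hlam.mk_fun_lt ((Cardinal.mk_subtype_le _).trans_lt
      (hlam.mk_prod_lt (hlam.mk_set_lt hι) (hlam.mk_set_lt hι))) hι)
    (fun a p => φ (d p) a) fun a ha b hb hab => ?_
  rw [Subgroup.mem_iInf]
  intro ε
  obtain ⟨p, hp⟩ := hcof ε
  exact hM hp (hφ _ a ha b hb (congrFun hab p))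

end Covers

/-! ### Ranks of partial preimages -/

section Lifts

variable {H G : ℕ → Type u} [∀ n, Group (H n)] [∀ n, Group (G n)]
  {π : ∀ ⦃m n : ℕ⦄, m ≤ n → G n →* G m}
  (ρ : ∀ ⦃m n : ℕ⦄, m ≤ n → H n →* H m)
  (σ : ∀ n, H n →* G n)

/-- The element `y` of `H n` has rank at least `δ` in the tree of partial `σ`-preimages of `a`. -/
def HasLiftRank (a : inverseLimit π) (δ : Ordinal.{u}) (n : ℕ) (y : H n) : Prop :=
  σ n y = a.1 n ∧ ∀ ε, ε < δ → ∃ y' : H (n + 1), ρ n.le_succ y' = y ∧ HasLiftRank a ε (n + 1) y'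
termination_by δ
decreasing_by assumption

variable {ρ σ}

theorem hasLiftRank_iff {a : inverseLimit π} {δ : Ordinal.{u}} {n : ℕ} {y : H n} :
    HasLiftRank ρ σ a δ n y ↔ σ n y = a.1 n ∧ ∀ ε, ε < δ →
      ∃ y' : H (n + 1), ρ n.le_succ y' = y ∧ HasLiftRank ρ σ a ε (n + 1) y' := by
  rw [HasLiftRank]

theorem HasLiftRank.anti {a : inverseLimit π} {δ ε : Ordinal.{u}} {n : ℕ} {y : H n}
    (h : HasLiftRank ρ σ a δ n y) (hε : ε ≤ δ) : HasLiftRank ρ σ a ε n y := by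
  rw [hasLiftRank_iff] at h ⊢
  exact ⟨h.1, fun ζ hζ => h.2 ζ (hζ.trans_le hε)⟩

theorem HasLiftRank.one (δ : Ordinal.{u}) (n : ℕ) :
    HasLiftRank ρ σ (1 : inverseLimit π) δ n 1 := by
  induction δ using WellFoundedLT.induction generalizing n with
  | ind δ ih =>
    rw [hasLiftRank_iff]
    exact ⟨by simp, fun ε hε => ⟨1, map_one _, ih ε hε _⟩⟩

theorem HasLiftRank.mul {a b : inverseLimit π} {δ : Ordinal.{u}} {n : ℕ} {y z : H n}
    (ha : HasLiftRank ρ σ a δ n y) (hb : HasLiftRank ρ σ b δ n z) :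
    HasLiftRank ρ σ (a * b) δ n (y * z) := by
  induction δ using WellFoundedLT.induction generalizing n with
  | ind δ ih =>
    rw [hasLiftRank_iff] at ha hb ⊢
    refine ⟨by simp [ha.1, hb.1], fun ε hε => ?_⟩
    obtain ⟨y', rfl, hy⟩ := ha.2 ε hε
    obtain ⟨z', rfl, hz⟩ := hb.2 ε hε
    exact ⟨y' * z', map_mul _ _ _, ih ε hε hy hz⟩

theorem HasLiftRank.inv {a : inverseLimit π} {δ : Ordinal.{u}} {n : ℕ} {y : H n}
    (ha : HasLiftRank ρ σ a δ n y) : HasLiftRank ρ σ a⁻¹ δ n y⁻¹ := by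
  induction δ using WellFoundedLT.induction generalizing n with
  | ind δ ih =>
    rw [hasLiftRank_iff] at ha ⊢
    refine ⟨by simp [ha.1], fun ε hε => ?_⟩
    obtain ⟨y', rfl, hy⟩ := ha.2 ε hε
    exact ⟨y'⁻¹, map_inv _ _, ih ε hε hy⟩

variable (ρ σ) in
/-- The elements `a` for which `1` has rank at least `δ` at level `n`. -/
def oneRankSubgroup (n : ℕ) (δ : Ordinal.{u}) : Subgroup (inverseLimit π) where
  carrier := {a | HasLiftRank ρ σ a δ n 1}
  one_mem' := HasLiftRank.one δ n
  mul_mem' ha hb := by simpa using ha.mul hb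
  inv_mem' ha := by simpa using ha.inv

variable (ρ σ) in
/-- The elements `a` for which some element of `H n` has rank at least `δ`. -/
def someRankSubgroup (n : ℕ) (δ : Ordinal.{u}) : Subgroup (inverseLimit π) where
  carrier := {a | ∃ y, HasLiftRank ρ σ a δ n y}
  one_mem' := ⟨1, HasLiftRank.one δ n⟩
  mul_mem' := fun ⟨y, ha⟩ ⟨z, hb⟩ => ⟨y * z, ha.mul hb⟩
  inv_mem' := fun ⟨y, ha⟩ => ⟨y⁻¹, ha.inv⟩

theorem mem_oneRankSubgroup {a : inverseLimit π} {n : ℕ} {δ : Ordinal.{u}} :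
    a ∈ oneRankSubgroup ρ σ n δ ↔ HasLiftRank ρ σ a δ n 1 := Iff.rfl

theorem oneRankSubgroup_antitone (n : ℕ) :
    Antitone (oneRankSubgroup (π := π) ρ σ n) := fun _ _ h _ ha => HasLiftRank.anti ha h

theorem someRankSubgroup_antitone (n : ℕ) :
    Antitone (someRankSubgroup (π := π) ρ σ n) := fun _ _ h _ ⟨y, ha⟩ => ⟨y, ha.anti h⟩

theorem oneRankSubgroup_le_someRankSubgroup (n : ℕ) (δ : Ordinal.{u}) :
    oneRankSubgroup (π := π) ρ σ n δ ≤ someRankSubgroup ρ σ n δ := fun _ ha => ⟨1, ha⟩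

theorem mem_oneRankSubgroup_zero {a : inverseLimit π} {n : ℕ} :
    a ∈ oneRankSubgroup ρ σ n 0 ↔ a.1 n = 1 := by
  rw [mem_oneRankSubgroup, hasLiftRank_iff]
  simp [eq_comm]

theorem iInf_oneRankSubgroup_succ_le {n : ℕ} {δ : Ordinal.{u}} (hδ : 0 < δ) :
    ⨅ ε : Set.Iio δ, oneRankSubgroup (π := π) ρ σ (n + 1) ε ≤ oneRankSubgroup ρ σ n δ := by
  intro a ha
  have ha' : ∀ ε, ε < δ → HasLiftRank ρ σ a ε (n + 1) 1 := fun ε hε => by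
    rw [Subgroup.mem_iInf] at ha
    exact ha ⟨ε, hε⟩
  rw [mem_oneRankSubgroup, hasLiftRank_iff]
  refine ⟨?_, fun ε hε => ⟨1, map_one _, ha' ε hε⟩⟩
  have h1 := (hasLiftRank_iff.1 (ha' 0 hδ)).1
  have h2 := a.2 n.le_succ
  rw [map_one] at h1 ⊢
  rw [← h2]
  exact (map_one (π n.le_succ)).symm.trans (congrArg (π n.le_succ) h1)

theorem HasLiftRank.of_succ
    (hσ : ∀ ⦃m n : ℕ⦄ (h : m ≤ n), (π h).comp (σ n) = (σ m).comp (ρ h))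
    {a : inverseLimit π} {δ : Ordinal.{u}} {n : ℕ} {y : H (n + 1)}
    (h : HasLiftRank ρ σ a δ (n + 1) y) : HasLiftRank ρ σ a δ n (ρ n.le_succ y) := by
  rw [hasLiftRank_iff]
  refine ⟨?_, fun ε hε => ⟨y, rfl, h.anti hε.le⟩⟩
  have h1 := DFunLike.congr_fun (hσ n.le_succ) y
  simp only [MonoidHom.comp_apply] at h1
  rw [← h1, (hasLiftRank_iff.1 h).1, a.2]

theorem oneRankSubgroup_anti_level
    (hσ : ∀ ⦃m n : ℕ⦄ (h : m ≤ n), (π h).comp (σ n) = (σ m).comp (ρ h))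
    {m n : ℕ} (h : m ≤ n) (δ : Ordinal.{u}) :
    oneRankSubgroup (π := π) ρ σ n δ ≤ oneRankSubgroup ρ σ m δ := by
  induction n, h using Nat.le_induction with
  | base => exact le_rfl
  | succ n _ ih =>
    refine le_trans (fun a ha => ?_) ih
    have := HasLiftRank.of_succ hσ ha
    rwa [map_one] at this

theorem range_inverseLimitMap_le_someRankSubgroup
    (hσ : ∀ ⦃m n : ℕ⦄ (h : m ≤ n), (π h).comp (σ n) = (σ m).comp (ρ h))
    (n : ℕ) (δ : Ordinal.{u}) :
    (inverseLimitMap σ hσ).range ≤ someRankSubgroup ρ σ n δ := by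
  rintro _ ⟨x, rfl⟩
  refine ⟨x.1 n, ?_⟩
  induction δ using WellFoundedLT.induction generalizing n with
  | ind δ ih =>
    rw [hasLiftRank_iff]
    exact ⟨rfl, fun ε hε => ⟨x.1 (n + 1), x.2 n.le_succ, ih ε hε _⟩⟩

/-- The candidates `y'` form a set, so ranks at which they fail would have a supremum; rank above it
for `y` gives a contradiction. -/
theorem exists_forall_hasLiftRank_succ {a : inverseLimit π} {n : ℕ} {y : H n}
    (h : ∀ δ, HasLiftRank ρ σ a δ n y) :
    ∃ y' : H (n + 1), ρ n.le_succ y' = y ∧ ∀ δ, HasLiftRank ρ σ a δ (n + 1) y' := by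
  by_contra! hcon
  have hex : ∀ y' : H (n + 1), ∃ δ, ρ n.le_succ y' = y → ¬ HasLiftRank ρ σ a δ (n + 1) y' := by
    intro y'
    by_cases hy : ρ n.le_succ y' = y
    · obtain ⟨δ, hδ⟩ := hcon y' hy
      exact ⟨δ, fun _ => hδ⟩
    · exact ⟨0, fun h => (hy h).elim⟩
  choose d hd using hex
  obtain ⟨y', hy, hr⟩ := (hasLiftRank_iff.1 (h (Order.succ (⨆ y', d y')))).2 (⨆ y', d y')
    (Order.lt_succ _)
  exact hd y' hy (hr.anti (Ordinal.le_iSup d y'))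

theorem mem_range_of_forall_hasLiftRank
    (hρ : InverseSystem (fun ⦃m n : ℕ⦄ (h : m ≤ n) => (ρ h : H n → H m)))
    (hσ : ∀ ⦃m n : ℕ⦄ (h : m ≤ n), (π h).comp (σ n) = (σ m).comp (ρ h))
    {a : inverseLimit π} {y : H 0} (h : ∀ δ, HasLiftRank ρ σ a δ 0 y) :
    a ∈ (inverseLimitMap σ hσ).range := by
  choose s hs hs' using fun (n : ℕ) (y : {y : H n // ∀ δ, HasLiftRank ρ σ a δ n y}) =>
    exists_forall_hasLiftRank_succ y.2
  let x : ∀ n, {y : H n // ∀ δ, HasLiftRank ρ σ a δ n y} :=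
    fun n => Nat.rec ⟨y, h⟩ (fun n y => ⟨s n y, hs' n y⟩) n
  have hx : ∀ n, ρ n.le_succ (x (n + 1)).1 = (x n).1 := fun n => hs n (x n)
  have hcoh : (fun n => (x n).1) ∈ inverseLimit ρ := by
    intro m n hmn
    induction n, hmn using Nat.le_induction with
    | base => exact hρ.map_self _
    | succ n hmn ih =>
      beta_reduce at ih ⊢
      rw [← ih, ← hx n]
      exact (hρ.map_map hmn n.le_succ _).symm
  refine ⟨⟨_, hcoh⟩, ?_⟩
  ext n
  exact (hasLiftRank_iff.1 ((x n).2 0)).1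

/-- The ranks stabilise: take the supremum over all `a` of a rank at which `a` fails. One `δ` serves
all levels because rank at level `n` passes down to level `0`. -/
theorem exists_oneRankSubgroup_le_range
    (hρ : InverseSystem (fun ⦃m n : ℕ⦄ (h : m ≤ n) => (ρ h : H n → H m)))
    (hσ : ∀ ⦃m n : ℕ⦄ (h : m ≤ n), (π h).comp (σ n) = (σ m).comp (ρ h)) :
    ∃ δ : Ordinal.{u}, ∀ n, oneRankSubgroup ρ σ n δ ≤ (inverseLimitMap σ hσ).range := by
  have hex : ∀ a : inverseLimit π, ∃ δ, HasLiftRank ρ σ a δ 0 1 →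
      a ∈ (inverseLimitMap σ hσ).range := by
    intro a
    by_cases h : ∀ δ, HasLiftRank ρ σ a δ 0 1
    · exact ⟨0, fun _ => mem_range_of_forall_hasLiftRank hρ hσ h⟩
    · push Not at h
      obtain ⟨δ, hδ⟩ := h
      exact ⟨δ, fun h => (hδ h).elim⟩
  choose d hd using hex
  refine ⟨⨆ a, d a, fun n a ha => hd a ?_⟩
  exact HasLiftRank.anti (oneRankSubgroup_anti_level hσ n.zero_le _ ha) (Ordinal.le_iSup d a)

/-- The subgroups `oneRankSubgroup` are closed under infinite products with factors in deeper
and deeper levels; such a product is given by its tails `a 0, a 1, …`. -/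
theorem HasLiftRank.of_tails
    {δ : Ordinal.{u}} {n : ℕ} {a : ℕ → inverseLimit π} (h1 : ∀ k, (a k).1 (n + k) = 1)
    (h2 : ∀ k, (a (k + 1))⁻¹ * a k ∈ oneRankSubgroup ρ σ (n + k) δ) :
    HasLiftRank ρ σ (a 0) δ n 1 := by
  induction δ using WellFoundedLT.induction generalizing n a with
  | ind δ ih =>
    rw [hasLiftRank_iff]
    refine ⟨by simpa using (h1 0).symm, fun ε hε => ?_⟩
    have htail : HasLiftRank ρ σ (a 1) ε (n + 1) 1 := by
      refine ih ε hε (n := n + 1) (a := fun k => a (k + 1)) (fun k => ?_) fun k => ?_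
      · rw [add_assoc, add_comm 1 k]; exact h1 (k + 1)
      · rw [add_assoc, add_comm 1 k]
        exact oneRankSubgroup_antitone _ hε.le (h2 (k + 1))
    -- As `a 0 = a 1 * ((a 1)⁻¹ * a 0)`, a lift for the second factor times the trivial lift for the
    -- tail `a 1` is a lift for `a 0`.
    obtain ⟨y', hy, hr⟩ := (hasLiftRank_iff.1 (h2 0)).2 ε hε
    refine ⟨y', hy, ?_⟩
    simpa using htail.mul hr

/-- Few cosets of `⨅ ε, oneRankSubgroup ρ σ n ε` cover `⨅ ε, someRankSubgroup ρ σ n ε`, for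
`ε` below any given ordinal. -/
theorem smallCosetCover_iInf_someRankSubgroup {lam : Cardinal.{u}} (hlam : lam.IsStrongLimit)
    {n : ℕ} (hH : Cardinal.mk (H n) < lam) (δ : Ordinal.{u}) :
    SmallCosetCover lam (⨅ ε : Set.Iio δ, oneRankSubgroup (π := π) ρ σ n ε)
      (⨅ ε : Set.Iio δ, someRankSubgroup ρ σ n ε) := by
  -- There may be too many ranks `ε` to record, so they are grouped by the subgroup `S` of elements
  -- of rank at least `ε` over `1`. The elements of rank at least `ε` over `a` form a coset of `S`,
  -- so `S` can stand in for `ε`.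
  refine SmallCosetCover.of_map (X := Set (H n) → Set (H n))
    (hlam.mk_fun_lt (hlam.mk_set_lt hH) (hlam.mk_set_lt hH))
    (fun a S => {y | ∃ ε, ε < δ ∧ {z | HasLiftRank ρ σ (1 : inverseLimit π) ε n z} = S ∧
      HasLiftRank ρ σ a ε n y}) fun a ha b hb hab => ?_
  rw [Subgroup.mem_iInf] at ha hb ⊢
  rintro ⟨ε, hε⟩
  obtain ⟨y, hy⟩ := ha ⟨ε, hε⟩
  obtain ⟨z, hz⟩ := hb ⟨ε, hε⟩
  have hmem := Set.ext_iff.1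
    (congrFun hab {z | HasLiftRank ρ σ (1 : inverseLimit π) ε n z}) y
  obtain ⟨ε', hε', hS, hy'⟩ := hmem.1 ⟨ε, hε, rfl, hy⟩
  have hyb : HasLiftRank ρ σ b ε n y := by
    rcases le_total ε ε' with hle | hle
    · exact hy'.anti hle
    · have h1 : HasLiftRank ρ σ (1 : inverseLimit π) ε' n (y * z⁻¹) := by
        simpa using hy'.mul (hz.anti hle).inv
      have h2 : HasLiftRank ρ σ (1 : inverseLimit π) ε n (y * z⁻¹) := (Set.ext_iff.1 hS _).1 h1
      simpa using h2.mul hz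
  have := HasLiftRank.mul hy hyb.inv
  rwa [mul_inv_cancel] at this

/-- If the subgroup `oneRankSubgroup ρ σ n δ` has many cosets in `A`, then so does some
`someRankSubgroup ρ σ (n + 1) ε` with `ε < δ`. -/
theorem exists_not_cosetCover_someRankSubgroup {lam : Cardinal.{u}} (hlam : lam.IsStrongLimit)
    {n : ℕ} (hH : Cardinal.mk (H (n + 1)) < lam) {δ : Ordinal.{u}} (hδ : 0 < δ)
    {A : Subgroup (inverseLimit π)} (hA : ¬ SmallCosetCover lam (oneRankSubgroup ρ σ n δ) A)
    {ι : Type u} (hι : Cardinal.mk ι < lam) :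
    ∃ ε < δ, ¬ CosetCover ι (someRankSubgroup ρ σ (n + 1) ε) A := by
  by_contra! h
  have : Nonempty (Set.Iio δ) := ⟨⟨0, hδ⟩⟩
  refine hA (((SmallCosetCover.iInf_of_antitone hlam
    (M := fun ε : Set.Iio δ => someRankSubgroup ρ σ (n + 1) ε) (fun _ _ hle =>
      someRankSubgroup_antitone _ hle) hι fun ε => h ε ε.2).trans hlam
    (smallCosetCover_iInf_someRankSubgroup hlam hH δ)).mono le_rfl
    (iInf_oneRankSubgroup_succ_le hδ))

end Lifts

/-! ### Joint ranks and the maximal tuple -/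

section Joint

variable {G : ℕ → Type u} [∀ n, Group (G n)] {π : ∀ ⦃m n : ℕ⦄, m ≤ n → G n →* G m}

variable (π) in
/-- The kernel of the projection of the inverse limit to `G n`. -/
def levelSubgroup (n : ℕ) : Subgroup (inverseLimit π) :=
  ((Pi.evalMonoidHom G n).comp (inverseLimit π).subtype).ker

theorem mem_levelSubgroup {n : ℕ} {a : inverseLimit π} : a ∈ levelSubgroup π n ↔ a.1 n = 1 :=
  Iff.rfl

theorem levelSubgroup_antitone : Antitone (levelSubgroup π) := by
  intro m n h a ha
  rw [mem_levelSubgroup] at ha ⊢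
  rw [← a.2 h, ha, map_one]

theorem smallCosetCover_levelSubgroup {lam : Cardinal.{u}} {n : ℕ} (hG : Cardinal.mk (G n) < lam) :
    SmallCosetCover lam (levelSubgroup π n) ⊤ := by
  refine SmallCosetCover.of_map hG (fun a => a.1 n) fun a _ b _ hab => ?_
  rw [mem_levelSubgroup]
  simpa [mul_inv_eq_one] using hab

variable {I : Type v} {H : I → ℕ → Type u} [∀ t n, Group (H t n)]
  (ρ : ∀ (t : I) ⦃m n : ℕ⦄, m ≤ n → H t n →* H t m) (σ : ∀ (t : I) (n : ℕ), H t n →* G n)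

/-- The elements of the kernel of the projection to `G n` for which, for all `t`, the element `1`
of `H t n` has rank at least `δ t`. -/
def jointRankSubgroup (n : ℕ) (δ : I → Ordinal.{u}) : Subgroup (inverseLimit π) :=
  levelSubgroup π n ⊓ ⨅ t, oneRankSubgroup (ρ t) (σ t) n (δ t)

variable {ρ σ}

theorem mem_jointRankSubgroup {n : ℕ} {δ : I → Ordinal.{u}} {a : inverseLimit π} :
    a ∈ jointRankSubgroup ρ σ n δ ↔
      a.1 n = 1 ∧ ∀ t, a ∈ oneRankSubgroup (ρ t) (σ t) n (δ t) := by
  rw [jointRankSubgroup, Subgroup.mem_inf, Subgroup.mem_iInf, mem_levelSubgroup]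

theorem levelSubgroup_le_jointRankSubgroup_zero (n : ℕ) :
    levelSubgroup π n ≤ jointRankSubgroup ρ σ n 0 := by
  intro a ha
  rw [mem_jointRankSubgroup]
  exact ⟨ha, fun t => mem_oneRankSubgroup_zero.2 ha⟩

/-- A tuple of ordinals is admissible if the joint rank subgroups strictly below it have many
cosets of each of the subgroups `K s`. -/
def IsAdmissible (lam : Cardinal.{u}) (ρ : ∀ (t : I) ⦃m n : ℕ⦄, m ≤ n → H t n →* H t m)
    (σ : ∀ (t : I) (n : ℕ), H t n →* G n) (K : I → Subgroup (inverseLimit π))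
    (γ : I → Ordinal.{u}) : Prop :=
  (∀ t, 0 < γ t) ∧ ∀ n δ, (∀ t, δ t < γ t) →
    ∀ s, ¬ SmallCosetCover lam (K s) (jointRankSubgroup ρ σ n δ)

theorem exists_maximal_isAdmissible [Finite I] {lam : Cardinal.{u}} (hlam : lam.IsStrongLimit)
    (hG : ∀ n, Cardinal.mk (G n) < lam) {K : I → Subgroup (inverseLimit π)}
    (hK : ∀ t, ¬ SmallCosetCover lam (K t) ⊤)
    (hKr : ∀ t, ∃ δ, ∀ n, oneRankSubgroup (ρ t) (σ t) n δ ≤ K t) :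
    ∃ γ, Maximal (IsAdmissible lam ρ σ K) γ := by
  classical
  choose Ω hΩ using hKr
  have hbdd : ∀ γ, IsAdmissible lam ρ σ K γ → γ ≤ Ω := by
    intro γ hγ t
    by_contra! hlt
    -- At rank `Ω t` the joint subgroup lies inside `K t`, so a single coset covers it.
    refine hγ.2 0 (Function.update 0 t (Ω t)) (fun r => ?_) t ?_
    · by_cases hr : r = t
      · subst hr; simpa using hlt
      · simpa [hr] using hγ.1 r
    · refine ⟨PUnit, ?_, 1, fun a ha => ⟨PUnit.unit, ?_⟩⟩
      · simpa using Cardinal.one_lt_aleph0.trans_le hlam.aleph0_le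
      · have h1 := (mem_jointRankSubgroup.1 ha).2 t
        rw [Function.update_self] at h1
        simpa using hΩ t 0 h1
  have hstart : IsAdmissible lam ρ σ K 1 := by
    refine ⟨fun t => by simp, fun n δ hδ s hs => ?_⟩
    have h0 : δ = 0 := by
      ext t
      simpa using hδ t
    subst h0
    exact hK s ((smallCosetCover_levelSubgroup (hG n)).trans hlam
      (hs.mono (levelSubgroup_le_jointRankSubgroup_zero n) le_rfl))
  have hub : ∀ c ⊆ {γ | IsAdmissible lam ρ σ K γ}, IsChain (· ≤ ·) c → ∀ y ∈ c,
      ∃ ub ∈ {γ | IsAdmissible lam ρ σ K γ}, ∀ z ∈ c, z ≤ ub := by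
    intro c hc hchain y hy
    have hb : ∀ t, BddAbove ((fun γ : I → Ordinal.{u} => γ t) '' c) := fun t => by
      refine ⟨Ω t, ?_⟩
      rintro _ ⟨γ, hγ, rfl⟩
      exact hbdd γ (hc hγ) t
    have hle : ∀ z ∈ c, z ≤ fun t => sSup ((fun γ : I → Ordinal.{u} => γ t) '' c) :=
      fun z hz t => le_csSup (hb t) ⟨z, hz, rfl⟩
    refine ⟨_, ⟨fun t => ((hc hy).1 t).trans_le (hle y hy t), fun n δ hδ => ?_⟩, hle⟩
    have hex : ∀ t, ∃ z : c, δ t < z.1 t := by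
      intro t
      obtain ⟨_, ⟨z, hz, rfl⟩, hlt⟩ := exists_lt_of_lt_csSup (Set.Nonempty.image _ ⟨y, hy⟩) (hδ t)
      exact ⟨⟨z, hz⟩, hlt⟩
    choose z hz using hex
    have : Nonempty c := ⟨⟨y, hy⟩⟩
    have hdir : Directed (· ≤ ·) (fun z : c => z.1) := hchain.directedOn.directed_val
    -- Finiteness of `I` is what puts a tuple strictly below the supremum strictly below one member
    -- of the chain.
    obtain ⟨w, hw⟩ := hdir.finite_le z
    exact (hc w.2).2 n δ fun t => (hz t).trans_le (hw t t)
  obtain ⟨γ, -, hγ⟩ := zorn_le_nonempty₀ _ hub 1 hstart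
  exact ⟨γ, hγ⟩

/-- Raising the coordinate `γ t` by one destroys admissibility, and the witness uses rank at most `γ
t` there. A small cover modulo rank `γ t` would compose with that witness to contradict
admissibility of `γ` itself. -/
theorem exists_threshold_of_maximal [Finite I] {lam : Cardinal.{u}} (hlam : lam.IsStrongLimit)
    (hσ : ∀ (t : I) ⦃m n : ℕ⦄ (h : m ≤ n), (π h).comp (σ t n) = (σ t m).comp (ρ t h))
    {K : I → Subgroup (inverseLimit π)} {γ : I → Ordinal.{u}}
    (hγ : Maximal (IsAdmissible lam ρ σ K) γ) :
    ∃ (m₀ : ℕ) (δ₀ : I → Ordinal.{u}), (∀ t, δ₀ t < γ t) ∧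
      ∀ m n, m₀ ≤ m → m ≤ n → ∀ δ, δ₀ ≤ δ → (∀ t, δ t < γ t) → ∀ t,
        ¬ SmallCosetCover lam (oneRankSubgroup (ρ t) (σ t) m (γ t))
          (jointRankSubgroup (π := π) ρ σ n δ) := by
  classical
  have hex : ∀ t, ∃ (m : ℕ) (δ : I → Ordinal.{u}) (s : I), δ t ≤ γ t ∧
      (∀ r, r ≠ t → δ r < γ r) ∧ SmallCosetCover lam (K s) (jointRankSubgroup ρ σ m δ) := by
    intro t
    by_contra! hcon
    have hadm : IsAdmissible lam ρ σ K (Function.update γ t (Order.succ (γ t))) := by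
      refine ⟨fun r => ?_, fun n δ hδ s => hcon n δ s ?_ fun r hr => ?_⟩
      · by_cases hr : r = t
        · subst hr; simp
        · simpa [hr] using hγ.1.1 r
      · have := hδ t
        rw [Function.update_self] at this
        exact Order.lt_succ_iff.1 this
      · simpa [hr] using hδ r
    have hle := hγ.2 hadm (by simp) t
    rw [Function.update_self] at hle
    exact (Order.lt_succ (γ t)).not_ge hle
  choose m δ s hδt hδr hs using hex
  obtain ⟨m₀, hm₀⟩ := Finite.exists_le m
  -- Only coordinates strictly below `γ r` are bounded: `δ r r` may equal `γ r`, and membership in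
  -- the rank `γ r` subgroup handles it.
  have hex' : ∀ r, ∃ b : Set.Iio (γ r), ∀ t, δ t r < γ r → δ t r ≤ b := by
    intro r
    have : Nonempty (Set.Iio (γ r)) := ⟨⟨0, hγ.1.1 r⟩⟩
    obtain ⟨b, hb⟩ := Finite.exists_le fun t : I =>
      if h : δ t r < γ r then (⟨δ t r, h⟩ : Set.Iio (γ r)) else ⟨0, hγ.1.1 r⟩
    refine ⟨b, fun t ht => ?_⟩
    have := hb t
    rw [dif_pos ht] at this
    exact this
  choose b hb using hex'
  refine ⟨m₀, fun r => (b r).1, fun r => (b r).2, fun k n hk hkn ε hε hεγ t hcov => ?_⟩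
  refine hγ.1.2 n ε hεγ (s t) (hcov.inf_left.trans hlam ((hs t).mono ?_ le_rfl))
  rintro a ⟨ha, hat⟩
  replace ha := mem_jointRankSubgroup.1 ha
  rw [mem_jointRankSubgroup]
  have hmk : m t ≤ k := (hm₀ t).trans hk
  refine ⟨levelSubgroup_antitone (hmk.trans hkn) ha.1, fun r => ?_⟩
  by_cases hr : r = t
  · subst hr
    exact oneRankSubgroup_anti_level (hσ r) hmk _ (oneRankSubgroup_antitone _ (hδt r) hat)
  · exact oneRankSubgroup_anti_level (hσ r) (hmk.trans hkn) _
      (oneRankSubgroup_antitone _ ((hb r t (hδr t r hr)).trans (hε r)) (ha.2 r))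

/-- The successor step of the tree construction: a joint rank subgroup contains many elements that
are separated by the subgroups `someRankSubgroup` of some larger ranks. -/
theorem exists_separated_jointRankSubgroup [Finite I] {lam : Cardinal.{u}}
    (hlam : lam.IsStrongLimit) {n : ℕ} (hH : ∀ t, Cardinal.mk (H t (n + 1)) < lam)
    {γ δ : I → Ordinal.{u}} (hδ : ∀ t, δ t < γ t)
    (hbig : ∀ t, ¬ SmallCosetCover lam (oneRankSubgroup (ρ t) (σ t) n (γ t))
      (jointRankSubgroup (π := π) ρ σ (n + 1) δ))
    {ι : Type u} (hι : Cardinal.mk ι < lam) :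
    ∃ ε : I → Ordinal.{u}, δ ≤ ε ∧ (∀ t, ε t < γ t) ∧ ∃ x : ι → inverseLimit π,
      (∀ i, x i ∈ jointRankSubgroup ρ σ (n + 1) δ) ∧
      ∀ i j, i ≠ j → ∀ t, x i * (x j)⁻¹ ∉ someRankSubgroup (ρ t) (σ t) (n + 1) (ε t) := by
  have := Fintype.ofFinite I
  obtain ⟨κ, hκ, hN⟩ := exists_forall_mul_inv_notMem (Γ := inverseLimit π) hlam
    (Finset.univ : Finset I) ι hι
  -- The bound `κ` in Neumann's lemma does not depend on the subgroups, so it can be fixed before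
  -- the ranks `ε`.
  choose ε hεγ hε using fun t => exists_not_cosetCover_someRankSubgroup hlam (hH t)
    (zero_le.trans_lt (hδ t)) (hbig t) hκ
  refine ⟨δ ⊔ ε, le_sup_left, fun t => max_lt (hδ t) (hεγ t), ?_⟩
  refine exists_pairwise_of_forall_exists
    (jointRankSubgroup (π := π) ρ σ (n + 1) δ : Set (inverseLimit π))
    (fun a b => ∀ t, a * b⁻¹ ∉ someRankSubgroup (ρ t) (σ t) (n + 1) ((δ ⊔ ε) t)) ?_ ?_
  · intro a b hab t hba
    exact hab t (by simpa using Subgroup.inv_mem _ hba)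
  · intro g
    obtain ⟨a, ha, hs⟩ := hN _ (fun t => someRankSubgroup (ρ t) (σ t) (n + 1) ((δ ⊔ ε) t))
      (fun t _ hcov => hε t (hcov.mono le_rfl (someRankSubgroup_antitone _ le_sup_right))) g
    exact ⟨a, ha, fun i t => hs t (Finset.mem_univ t) i⟩

end Joint

/-! ### Infinite products -/

section LimitProduct

variable {G : ℕ → Type u} [∀ n, Group (G n)] {π : ∀ ⦃m n : ℕ⦄, m ≤ n → G n →* G m}

/-- The product `x (k - 1) * ⋯ * x 0`. -/
def tailProd {Γ : Type*} [Group Γ] (x : ℕ → Γ) : ℕ → Γ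
  | 0 => 1
  | k + 1 => x k * tailProd x k

theorem tailProd_congr {Γ : Type*} [Group Γ] {x y : ℕ → Γ} {k : ℕ} (h : ∀ j < k, x j = y j) :
    tailProd x k = tailProd y k := by
  induction k with
  | zero => rfl
  | succ k ih =>
    rw [tailProd, tailProd, h k k.lt_succ_self, ih fun j hj => h j (hj.trans k.lt_succ_self)]

theorem tailProd_apply_eq {x : ℕ → inverseLimit π} {m n k l : ℕ}
    (hx : ∀ k, x k ∈ levelSubgroup π (m + k)) (hkl : k ≤ l) (hn : n ≤ m + k) :
    (tailProd x l).1 n = (tailProd x k).1 n := by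
  induction l, hkl using Nat.le_induction with
  | base => rfl
  | succ l hl ih =>
    rw [← ih, tailProd]
    have h1 : (x l).1 n = 1 := levelSubgroup_antitone (hn.trans (by omega)) (hx l)
    simp [h1]

/-- The infinite product `⋯ * x 1 * x 0` of elements of deeper and deeper level. -/
def limitProd (x : ℕ → inverseLimit π) (m : ℕ) (hx : ∀ k, x k ∈ levelSubgroup π (m + k)) :
    inverseLimit π :=
  -- Factors from index `n` on are trivial at coordinate `n`, so `n` factors suffice.
  ⟨fun n => (tailProd x n).1 n, fun k l h => by
    rw [(tailProd x l).2 h]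
    exact tailProd_apply_eq hx h (by omega)⟩

theorem limitProd_apply {x : ℕ → inverseLimit π} {m n k : ℕ}
    (hx : ∀ k, x k ∈ levelSubgroup π (m + k)) (hn : n ≤ m + k) :
    (limitProd x m hx).1 n = (tailProd x k).1 n := by
  rw [← tailProd_apply_eq hx (le_max_right n k) hn]
  exact (tailProd_apply_eq hx (le_max_left n k) (by omega)).symm

theorem limitProd_mul_inv_tailProd_mem {H : ℕ → Type u} [∀ n, Group (H n)]
    {ρ : ∀ ⦃m n : ℕ⦄, m ≤ n → H n →* H m} {σ : ∀ n, H n →* G n}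
    {x : ℕ → inverseLimit π} {m k n : ℕ}
    (hx : ∀ k, x k ∈ levelSubgroup π (m + k)) {δ : Ordinal.{u}} (hn : n ≤ m + k)
    (h : ∀ j, x (k + j) ∈ oneRankSubgroup ρ σ (n + j) δ) :
    limitProd x m hx * (tailProd x k)⁻¹ ∈ oneRankSubgroup ρ σ n δ := by
  refine HasLiftRank.of_tails (a := fun j => limitProd x m hx * (tailProd x (k + j))⁻¹)
    (fun j => ?_) fun j => ?_
  · have := limitProd_apply hx (n := n + j) (k := k + j) (by omega)
    simp [this]
  · have h1 : tailProd x (k + (j + 1)) = x (k + j) * tailProd x (k + j) := rfl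
    have h2 : (limitProd x m hx * (tailProd x (k + (j + 1)))⁻¹)⁻¹ *
        (limitProd x m hx * (tailProd x (k + j))⁻¹) = x (k + j) := by
      rw [h1]; group
    rw [h2]
    exact h j

end LimitProduct

/-! ### The tree of products and the conclusion -/

theorem exists_separated_pi {G : ℕ → Type u} [∀ n, Group (G n)]
    {π : ∀ ⦃m n : ℕ⦄, m ≤ n → G n →* G m} {I : Type v} [Finite I] {H : I → ℕ → Type u}
    [∀ t n, Group (H t n)] {ρ : ∀ (t : I) ⦃m n : ℕ⦄, m ≤ n → H t n →* H t m}
    {σ : ∀ (t : I) (n : ℕ), H t n →* G n} {lam : Cardinal.{u}} (hlam : lam.IsStrongLimit)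
    (hG : ∀ n, Cardinal.mk (G n) < lam) (hH : ∀ t n, Cardinal.mk (H t n) < lam)
    (hρ : ∀ t, InverseSystem (fun ⦃m n : ℕ⦄ (h : m ≤ n) => (ρ t h : H t n → H t m)))
    (hσ : ∀ (t : I) ⦃m n : ℕ⦄ (h : m ≤ n), (π h).comp (σ t n) = (σ t m).comp (ρ t h))
    (hbig : ∀ t, ¬ SmallCosetCover lam (inverseLimitMap (σ t) (hσ t)).range ⊤)
    {ι : ℕ → Type u} (hι : ∀ k, Cardinal.mk (ι k) < lam) :
    ∃ f : (∀ k, ι k) → inverseLimit π, ∀ η ν, η ≠ ν → ∀ t,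
      f η * (f ν)⁻¹ ∉ (inverseLimitMap (σ t) (hσ t)).range := by
  classical
  obtain ⟨γ, hγ⟩ := exists_maximal_isAdmissible (ρ := ρ) (σ := σ) hlam hG hbig
    fun t => exists_oneRankSubgroup_le_range (hρ t) (hσ t)
  obtain ⟨m, δ₀, hδ₀, hm⟩ := exists_threshold_of_maximal hlam hσ hγ
  choose next hle hlt y hyr hys using
    fun (k : ℕ) (δ : {δ : I → Ordinal.{u} // δ₀ ≤ δ ∧ ∀ t, δ t < γ t}) =>
      exists_separated_jointRankSubgroup (π := π) hlam (fun t => hH t (m + k + 1)) δ.2.2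
        (fun t => hm (m + k) (m + k + 1) (by omega) (by omega) δ δ.2.1 δ.2.2 t) (hι k)
  let d : ℕ → {δ : I → Ordinal.{u} // δ₀ ≤ δ ∧ ∀ t, δ t < γ t} := fun k =>
    Nat.rec ⟨δ₀, le_rfl, hδ₀⟩ (fun k δ => ⟨next k δ, δ.2.1.trans (hle k δ), hlt k δ⟩) k
  have hd : ∀ k, (d (k + 1)).1 = next k (d k) := fun k => rfl
  have hmono : Monotone fun k => (d k).1 := monotone_nat_of_le_succ fun k => hle k (d k)
  let x : ∀ k, ι k → inverseLimit π := fun k => y k (d k)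
  have hx : ∀ k i, x k i ∈ jointRankSubgroup ρ σ (m + k + 1) (d k).1 := fun k => hyr k (d k)
  have hsep : ∀ k i j, i ≠ j → ∀ t,
      x k i * (x k j)⁻¹ ∉ someRankSubgroup (ρ t) (σ t) (m + k + 1) ((d (k + 1)).1 t) :=
    fun k => hys k (d k)
  have hlev : ∀ (η : ∀ k, ι k) k, x k (η k) ∈ levelSubgroup π (m + k) := fun η k =>
    levelSubgroup_antitone (by omega) (mem_jointRankSubgroup.1 (hx k (η k))).1
  refine ⟨fun η => limitProd (fun k => x k (η k)) m (hlev η), fun η ν hne t hmem => ?_⟩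
  have hex : ∃ k, η k ≠ ν k := Function.ne_iff.1 hne
  set k := Nat.find hex with hk
  have hprod : tailProd (fun k => x k (η k)) k = tailProd (fun k => x k (ν k)) k :=
    tailProd_congr fun j hj => by
      have : η j = ν j := not_not.1 (Nat.find_min hex hj)
      rw [this]
  -- Factors after the split at `k` were chosen at ranks at least `d (k + 1)`, the rank separating
  -- the two factors at `k`.
  have htail : ∀ η : ∀ k, ι k,
      limitProd (fun k => x k (η k)) m (hlev η) * (tailProd (fun k => x k (η k)) (k + 1))⁻¹ ∈
        someRankSubgroup (ρ t) (σ t) (m + k + 1) ((d (k + 1)).1 t) := fun η => by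
    refine oneRankSubgroup_le_someRankSubgroup _ _
      (limitProd_mul_inv_tailProd_mem _ (by omega) fun j => ?_)
    exact oneRankSubgroup_anti_level (hσ t) (by omega) _ (oneRankSubgroup_antitone _
      (hmono (Nat.le_add_right (k + 1) j) t) ((mem_jointRankSubgroup.1 (hx (k + 1 + j) _)).2 t))
  refine hsep k (η k) (ν k) (Nat.find_spec hex) t ?_
  have h1 := Subgroup.mul_mem _ (Subgroup.mul_mem _ (Subgroup.inv_mem _ (htail η))
    (range_inverseLimitMap_le_someRankSubgroup (hσ t) (m + k + 1) ((d (k + 1)).1 t) hmem))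
    (htail ν)
  have h2 : x k (η k) * (x k (ν k))⁻¹ =
      tailProd (fun k => x k (η k)) (k + 1) * (tailProd (fun k => x k (ν k)) (k + 1))⁻¹ := by
    rw [tailProd, tailProd, hprod]; group
  rw [h2]
  convert h1 using 1
  group

theorem theorem1p1 (lam : Cardinal.{u})
    (hlam : lam = Cardinal.aleph0 ∨
      (lam.IsStrongLimit ∧ lam.ord.cof = Cardinal.aleph0))
    -- the inverse system `G`
    (G : ℕ → Type u) [∀ n, Group (G n)]
    (π : ∀ ⦃m n : ℕ⦄, m ≤ n → G n →* G m)
    (hπ : InverseSystem (fun ⦃m n : ℕ⦄ (h : m ≤ n) => (π h : G n → G m)))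
    (hG : ∀ n, Cardinal.mk (G n) < lam)
    -- the finitely many inverse systems `H t`
    (I : Type v) [Finite I]
    (H : I → ℕ → Type u) [∀ t n, Group (H t n)]
    (ρ : ∀ (t : I) ⦃m n : ℕ⦄, m ≤ n → H t n →* H t m)
    (hρ : ∀ t, InverseSystem (fun ⦃m n : ℕ⦄ (h : m ≤ n) => (ρ t h : H t n → H t m)))
    (hH : ∀ t n, Cardinal.mk (H t n) < lam)
    -- the compatible homomorphisms
    (σ : ∀ (t : I) (n : ℕ), H t n →* G n)
    (hσ : ∀ (t : I) ⦃m n : ℕ⦄ (h : m ≤ n), (π h).comp (σ t n) = (σ t m).comp (ρ t h))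
    -- `Quotient.out μ` is a type of cardinality `μ`
    (hsep : ∀ μ : Cardinal.{u}, μ < lam →
      ∃ f : Quotient.out μ → inverseLimit π, ∀ i j, i ≠ j → ∀ t,
        f i * (f j)⁻¹ ∉ (inverseLimitMap (σ t) (hσ t)).range) :
    ∃ f : Quotient.out ((2 : Cardinal.{u}) ^ lam) → inverseLimit π, ∀ i j, i ≠ j → ∀ t,
      f i * (f j)⁻¹ ∉ (inverseLimitMap (σ t) (hσ t)).range := by

  have hsl : lam.IsStrongLimit := by
    rcases hlam with rfl | h
    · exact Cardinal.isStrongLimit_aleph0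
    · exact h.1
  have hcof : lam.ord.cof = Cardinal.aleph0 := by
    rcases hlam with rfl | h
    · rw [Cardinal.ord_aleph0, Ordinal.cof_omega0]
    · exact h.2
  have hbig : ∀ t, ¬ SmallCosetCover lam (inverseLimitMap (σ t) (hσ t)).range ⊤ := by
    rintro t ⟨ι, hι, hcov⟩
    -- A separated family of size `2 ^ |ι|`, still below `lam`, cannot inject into `ι` cosets.
    obtain ⟨f, hf⟩ := hsep _ (hsl.mk_set_lt hι)
    obtain ⟨e, he⟩ := hcov.injective_of_separated (fun _ => Subgroup.mem_top _)
      fun i j hij => hf i j hij t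
    have h1 := Cardinal.mk_le_of_injective he
    rw [Cardinal.mk_out, Cardinal.mk_set] at h1
    exact (Cardinal.cantor _).not_ge h1
  obtain ⟨κ, hκ, hpow⟩ := hsl.exists_two_power_le_mk_pi hcof
  obtain ⟨f, hf⟩ := exists_separated_pi hsl hG hH hρ hσ hbig fun k => hsl.mk_set_lt (hκ k)
  rw [← Cardinal.mk_out ((2 : Cardinal.{u}) ^ lam), Cardinal.le_def] at hpow
  obtain ⟨e⟩ := hpow
  exact ⟨f ∘ e, fun i j hij => hf _ _ (e.injective.ne hij)⟩
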